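/- Let $K,N\ge 1$ be integers, $p_1,\dots,p_K>0$ and $\sigma>0$. Consider the synchronous multi-code CDMA system with $K$ users, processing gain $N$, power profile $p=(p_1,\dots,p_K)$, additive white Gaussian noise of variance $\sigma^2$ per dimension, and an upper-limit profile $\bar n=(\bar n_1,\dots,\bar n_K)$ of positive integers, where $\bar n_k$ bounds the number of multi-codes (active data streams) of user $k$. Its maximum sum rate, in bits per chip, is $$\mathcal C_{\mathrm{CDMA}}(p,\bar n,N,\sigma^2)=\sup\ \frac1{2N}\log_2\det\Big(I_N+\frac1{\sigma^2}\,SPS^{T}\Big),$$ where $S=[S_1,\dots,S_K]$, $P=\mathrm{diag}(P_1,\dots,P_K)$, and the supremum is over all real $N\times\bar n_k$ signature-sequence matrices $S_k$ and all real positive semidefinite $\bar n_k\times\bar n_k$ data-correlation matrices $P_k$ with $\frac1N\mathrm{tr}(S_kP_kS_k^{T})=p_k$ for every $k$. The sum capacity of the Gaussian multiple-access channel (MAC) is $$\mathcal C_{\mathrm{MAC}}=\frac12\log_2\Big(1+\frac{\sum_{k=1}^K p_k}{\sigma^2}\Big),$$ and $\bar n$ is said to achieve it if $\mathcal C_{\mathrm{CDMA}}(p,\bar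 n,N,\sigma^2)=\mathcal C_{\mathrm{MAC}}$. Order the profiles componentwise. Then there is exactly one minimal profile among those that achieve the sum capacity of the MAC; its entries are $$\bar n_k^{\min}=\left\lceil N\,\frac{p_k}{\sum_{k'=1}^{K}p_{k'}}\right\rceil,\qquad k=1,\dots,K,$$ and it is the least element of that set. For this profile the supremum is attained, i.e. some feasible $(S_k,P_k)_k$ has sum rate exactly $\mathcal C_{\mathrm{MAC}}$. Consequently, the minimum total number $\sum_k\bar n_k$ of multi-codes over the profiles that achieve the sum capacity equals $\sum_{k}\bar n_k^{\min}$, and $$\sum_{k=1}^{K}\bar n_k^{\min}\le N+(K-1).$$ -/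

import Mathlib

noncomputable section

namespace MultiCodeCDMA

/-- The signature-sequence matrix `S = [S₁, S₂, …, S_K]`, whose columns are indexed by the pairs
`(k, l)` with `l < n k` (the `l`-th data stream of user `k`). -/
def signatureMatrix {K N : ℕ} {n : Fin K → ℕ}
    (S : (k : Fin K) → Matrix (Fin N) (Fin (n k)) ℝ) :
    Matrix (Fin N) ((k : Fin K) × Fin (n k)) ℝ :=
  Matrix.of fun i kl => S kl.1 i kl.2

/-- The sum rate `(1 / (2N)) log₂ det (I + σ⁻² S P Sᵀ)` in bits per chip, where
`P = diag (P₁, …, P_K)` is block diagonal. -/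
def sumRate {K N : ℕ} {n : Fin K → ℕ} (σ : ℝ)
    (P : (k : Fin K) → Matrix (Fin (n k)) (Fin (n k)) ℝ)
    (S : (k : Fin K) → Matrix (Fin N) (Fin (n k)) ℝ) : ℝ :=
  1 / (2 * (N : ℝ)) * Real.logb 2
    (1 + (1 / σ ^ 2) •
      (signatureMatrix S * Matrix.blockDiagonal' P * (signatureMatrix S).transpose)).det

/-- Feasibility of data-correlation matrices `P k` and signature-sequence matrices `S k` for the
power profile `p`: every `P k` is positive semidefinite, and user `k` has average power `p k`. -/
structure Feasible {K N : ℕ} {n : Fin K → ℕ} (p : Fin K → ℝ)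
    (P : (k : Fin K) → Matrix (Fin (n k)) (Fin (n k)) ℝ)
    (S : (k : Fin K) → Matrix (Fin N) (Fin (n k)) ℝ) : Prop where
  posSemidef : ∀ k, (P k).PosSemidef
  power : ∀ k, 1 / (N : ℝ) * (S k * P k * (S k).transpose).trace = p k

/-- The set of sum rates of the multi-code CDMA system with power profile `p`, upper-limit profile
`n` on the numbers of multi-codes, processing gain `N` and noise variance `σ²` per dimension. A
user may have fewer than `n k` active streams, since streams may have zero power. -/
def sumRates {K : ℕ} (p : Fin K → ℝ) (n : Fin K → ℕ) (N : ℕ) (σ : ℝ) : Set ℝ :=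
  {r | ∃ (P : (k : Fin K) → Matrix (Fin (n k)) (Fin (n k)) ℝ)
        (S : (k : Fin K) → Matrix (Fin N) (Fin (n k)) ℝ),
        Feasible p P S ∧ r = sumRate σ P S}

/-- The maximum sum rate of the multi-code CDMA system. -/
def maxSumRate {K : ℕ} (p : Fin K → ℝ) (n : Fin K → ℕ) (N : ℕ) (σ : ℝ) : ℝ :=
  sSup (sumRates p n N σ)

/-- The sum capacity `w log₂ (1 + (∑ p_k) / (N₀ w))` of the Gaussian multiple-access channel with
total bandwidth `w` and one-sided noise power spectral density `N₀`. -/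
def macSumCapacity {K : ℕ} (p : Fin K → ℝ) (w N₀ : ℝ) : ℝ :=
  w * Real.logb 2 (1 + (∑ k, p k) / (N₀ * w))

/-- The upper-limit profile `n` (a profile of positive integers) achieves the sum capacity of the
multiple-access channel, which per chip is that with bandwidth `1 / 2` and density `2 σ²`. -/
def AchievesSumCapacity {K : ℕ} (p : Fin K → ℝ) (N : ℕ) (σ : ℝ) (n : Fin K → ℕ) : Prop :=
  (∀ k, 1 ≤ n k) ∧ maxSumRate p n N σ = macSumCapacity p (1 / 2) (2 * σ ^ 2)

/-- The profile with entries `⌈N p_k / ∑ p_k'⌉`. -/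
def ceilProfile {K : ℕ} (p : Fin K → ℝ) (N : ℕ) : Fin K → ℕ :=
  fun k => ⌈(N : ℝ) * (p k / ∑ k', p k')⌉₊

end MultiCodeCDMA

end

/-! The power constraints fix the trace of the covariance, hence its mean eigenvalue `μ = 1 + T /
σ²` with `T = ∑ p k`. By AM-GM the rate is at most the MAC capacity, with equality exactly for a
white covariance (`log_det_le`). Necessity: the signal of user `k` has rank at most `n k` and trace
`N p k`, so it forces a covariance eigenvalue of at least `1 + N p k / (n k σ²)`
(`exists_le_eigenvalue`). If `n k < N p k / T`, this exceeds `μ`, and `log_det_le_sub` gives a loss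
of rate. Sufficiency: if `n k ≥ N p k / T` for all `k`, a Parseval frame with squared norms `N p k /
(T n k) ≤ 1` whitens the covariance. Such a frame comes from Givens rotations
(`exists_parseval_colSq_eq`), a form of the Schur-Horn theorem. -/

namespace MultiCodeCDMA

open Matrix

/-! ### Parseval frames with prescribed norms -/

section Frames

variable {m ι : Type*} [Fintype ι]

/-- The squared Euclidean norm of a column of a matrix. -/
def colSq [Fintype m] (V : Matrix m ι ℝ) (x : ι) : ℝ := ∑ a, V a x ^ 2

lemma sum_colSq [Fintype m] (V : Matrix m ι ℝ) : ∑ x, colSq V x = (V * Vᵀ).trace := by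
  simp only [colSq, trace, diag, mul_apply, transpose_apply]
  rw [Finset.sum_comm]
  simp [sq]

variable [DecidableEq ι]

/-- The Givens rotation of the columns `i` and `j` of a matrix. -/
def rotate (V : Matrix m ι ℝ) (i j : ι) (c s : ℝ) : Matrix m ι ℝ :=
  Matrix.of fun a x =>
    if x = i then c * V a i + s * V a j else if x = j then -s * V a i + c * V a j else V a x

lemma rotate_mul_transpose (V : Matrix m ι ℝ) {i j : ι} (hij : i ≠ j) {c s : ℝ}
    (hcs : c ^ 2 + s ^ 2 = 1) : rotate V i j c s * (rotate V i j c s)ᵀ = V * Vᵀ := by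
  ext a b
  simp only [mul_apply, transpose_apply]
  have hj : j ∈ Finset.univ.erase i := by simp [hij.symm]
  rw [← Finset.add_sum_erase _ _ (Finset.mem_univ i), ← Finset.add_sum_erase _ _ hj,
    ← Finset.add_sum_erase _ _ (Finset.mem_univ i), ← Finset.add_sum_erase _ _ hj,
    ← add_assoc, ← add_assoc]
  congr 1
  · simp only [rotate, of_apply, if_true, hij.symm, if_false]
    linear_combination (V a i * V b i + V a j * V b j) * hcs
  · refine Finset.sum_congr rfl fun x hx => ?_
    simp only [Finset.mem_erase, Finset.mem_univ, and_true] at hx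
    simp [rotate, hx.1, hx.2]

variable [Fintype m]

/-- A rotation of two columns gives one of them any squared norm between the two. -/
lemma exists_rotate (V : Matrix m ι ℝ) {i j : ι} (hij : i ≠ j) {r : ℝ}
    (hr : r ∈ Set.uIcc (colSq V i) (colSq V j)) :
    ∃ W : Matrix m ι ℝ, W * Wᵀ = V * Vᵀ ∧ colSq W i = r ∧
      ∀ x, x ≠ i → x ≠ j → colSq W x = colSq V x := by
  -- A quarter turn carries column `j` into position `i`, so the intermediate value theorem applies
  -- on `[0, π / 2]`.
  let g : ℝ → ℝ := fun t => colSq (rotate V i j (Real.cos t) (Real.sin t)) i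
  have hg : Continuous g := by
    simp only [g, colSq, rotate, of_apply, if_true]
    fun_prop
  have h0 : g 0 = colSq V i := by simp [g, colSq, rotate]
  have h1 : g (Real.pi / 2) = colSq V j := by simp [g, colSq, rotate]
  rw [← h0, ← h1] at hr
  obtain ⟨t, -, ht⟩ := intermediate_value_uIcc hg.continuousOn hr
  refine ⟨_, rotate_mul_transpose V hij (Real.cos_sq_add_sin_sq t), ht, fun x hi hj => ?_⟩
  simp [colSq, rotate, hi, hj]

/-- The induction behind `exists_parseval_colSq_eq`: all columns but one whose squared norm still
differs from the target have squared norm `0` or `1`. -/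
lemma exists_colSq_eq_of_unmatched [DecidableEq m] {f : ι → ℝ} (h0 : ∀ x, 0 ≤ f x)
    (h1 : ∀ x, f x ≤ 1) (hf : ∑ x, f x = Fintype.card m) (k : ℕ) (V : Matrix m ι ℝ)
    (hV : V * Vᵀ = 1) (hk : (Finset.univ.filter fun x => colSq V x ≠ f x).card ≤ k)
    (hfrac : ∃ x, ∀ y, y ≠ x → colSq V y ≠ f y → colSq V y = 0 ∨ colSq V y = 1) :
    ∃ W : Matrix m ι ℝ, W * Wᵀ = 1 ∧ ∀ x, colSq W x = f x := by
  induction k generalizing V with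
  | zero =>
    refine ⟨V, hV, fun x => ?_⟩
    by_contra hx
    have : x ∈ (Finset.univ.filter fun x => colSq V x ≠ f x) := by simpa using hx
    simp [Finset.card_eq_zero.1 (Nat.le_zero.1 hk)] at this
  | succ k ih =>
    by_cases hall : ∀ x, colSq V x = f x
    · exact ⟨V, hV, hall⟩
    obtain ⟨x, hx, hxo⟩ : ∃ x, colSq V x ≠ f x ∧
        ∀ y, y ≠ x → colSq V y ≠ f y → colSq V y = 0 ∨ colSq V y = 1 := by
      obtain ⟨x, hx⟩ := hfrac
      by_cases hxf : colSq V x = f x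
      · push Not at hall
        obtain ⟨z, hz⟩ := hall
        exact ⟨z, hz, fun y _ hy => hx y (fun h => hy (h ▸ hxf)) hy⟩
      · exact ⟨x, hxf, hx⟩
    have hsum : ∑ y, colSq V y = ∑ y, f y := by rw [sum_colSq, hV, trace_one, hf]
    obtain ⟨j, hjx, hjf, hj⟩ : ∃ j, j ≠ x ∧ colSq V j ≠ f j ∧
        f x ∈ Set.uIcc (colSq V x) (colSq V j) := by
      -- The sums agree, so an error at `x` is offset by an opposite error at some `j`. As `f` takes
      -- values in `[0, 1]`, column `j` has squared norm `1` if in excess and `0` if in deficit, so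
      -- `f x` lies between the two norms.
      rcases lt_or_gt_of_ne hx with h | h
      · obtain ⟨j, hj⟩ : ∃ j, f j < colSq V j := by
          by_contra! hc
          exact absurd hsum (Finset.sum_lt_sum (fun y _ => hc y) ⟨x, Finset.mem_univ x, h⟩).ne
        have hjx : j ≠ x := by rintro rfl; linarith
        refine ⟨j, hjx, hj.ne', ?_⟩
        rcases hxo j hjx hj.ne' with h' | h'
        · linarith [h0 j]
        · exact Set.Icc_subset_uIcc ⟨h.le, h' ▸ h1 x⟩
      · obtain ⟨j, hj⟩ : ∃ j, colSq V j < f j := by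
          by_contra! hc
          exact absurd hsum (Finset.sum_lt_sum (fun y _ => hc y) ⟨x, Finset.mem_univ x, h⟩).ne'
        have hjx : j ≠ x := by rintro rfl; linarith
        refine ⟨j, hjx, hj.ne, ?_⟩
        rcases hxo j hjx hj.ne with h' | h'
        · exact Set.Icc_subset_uIcc' ⟨h' ▸ h0 x, h.le⟩
        · linarith [h1 j]
    obtain ⟨W, hW, hWx, hWo⟩ := exists_rotate V hjx.symm hj
    -- Now `x` is matched for good, and `j` becomes the one exceptional column.
    refine ih W (hW.trans hV) ?_ ⟨j, fun y hyj hy => ?_⟩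
    · have hlt : (Finset.univ.filter fun y => colSq W y ≠ f y).card <
          (Finset.univ.filter fun y => colSq V y ≠ f y).card := by
        refine Finset.card_lt_card (Finset.ssubset_iff_of_subset ?_ |>.2 ⟨x, ?_, ?_⟩)
        · intro y hy
          simp only [Finset.mem_filter, Finset.mem_univ, true_and] at hy ⊢
          have hyx : y ≠ x := by rintro rfl; exact hy hWx
          by_cases hyj : y = j
          · subst hyj
            exact hjf
          · rwa [← hWo y hyx hyj]
        · simpa using hx
        · simpa using hWx
      omega
    · have hyx : y ≠ x := by rintro rfl; exact hy hWx
      rw [hWo y hyx hyj] at hy ⊢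
      exact hxo y hyx hy

/-- Numbers in `[0, 1]` whose sum is the dimension are the squared norms of the vectors of some
Parseval frame. -/
theorem exists_parseval_colSq_eq [DecidableEq m] {f : ι → ℝ} (h0 : ∀ x, 0 ≤ f x)
    (h1 : ∀ x, f x ≤ 1) (hf : ∑ x, f x = Fintype.card m) :
    ∃ V : Matrix m ι ℝ, V * Vᵀ = 1 ∧ ∀ x, colSq V x = f x := by
  have hcard : Fintype.card m ≤ Fintype.card ι := by
    have : ∑ x, f x ≤ ∑ _x : ι, (1 : ℝ) := Finset.sum_le_sum fun x _ => h1 x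
    rw [hf] at this
    simpa using this
  obtain ⟨e⟩ := Function.Embedding.nonempty_of_card_le hcard
  -- Start from an orthonormal basis padded with zero columns.
  let V : Matrix m ι ℝ := Matrix.of fun a x => if e a = x then 1 else 0
  have hV : V * Vᵀ = 1 := by
    ext a b
    simp [V, mul_apply, one_apply, e.injective.eq_iff, eq_comm]
  have hbin : ∀ x, colSq V x = 0 ∨ colSq V x = 1 := by
    intro x
    by_cases hx : ∃ a, e a = x
    · obtain ⟨a, rfl⟩ := hx
      simp [colSq, V, e.injective.eq_iff]
    · push Not at hx
      simp [colSq, V, hx]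
  by_cases hι : Nonempty ι
  · obtain ⟨x⟩ := hι
    exact exists_colSq_eq_of_unmatched h0 h1 hf _ V hV le_rfl ⟨x, fun y _ _ => hbin y⟩
  · rw [not_nonempty_iff] at hι
    exact ⟨V, hV, isEmptyElim⟩

end Frames

/-! ### Determinant and eigenvalue bounds -/

section Spectral

/-- The tangent line of the logarithm at `y`. -/
lemma log_le_log_add {x y : ℝ} (hx : 0 < x) (hy : 0 < y) :
    Real.log x ≤ Real.log y + (x / y - 1) := by
  have := Real.log_le_sub_one_of_pos (div_pos hx hy)
  rw [Real.log_div hx.ne' hy.ne'] at this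
  linarith

variable {m : Type*} [Fintype m] [DecidableEq m]

/-- The arithmetic-geometric mean inequality for the eigenvalues of a positive definite matrix. -/
lemma log_det_le {A : Matrix m m ℝ} (hA : A.PosDef) {μ : ℝ} (hμ : 0 < μ)
    (htr : A.trace = Fintype.card m * μ) : Real.log A.det ≤ Fintype.card m * Real.log μ := by
  have hpos := hA.eigenvalues_pos
  have hsum : ∑ i, hA.1.eigenvalues i = Fintype.card m * μ := by
    rw [← htr, hA.1.trace_eq_sum_eigenvalues]; simp
  have hdet : A.det = ∏ i, hA.1.eigenvalues i := by
    rw [hA.1.det_eq_prod_eigenvalues]; simp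
  rw [hdet, Real.log_prod fun i _ => (hpos i).ne']
  calc ∑ i, Real.log (hA.1.eigenvalues i)
      ≤ ∑ i, (Real.log μ + (hA.1.eigenvalues i / μ - 1)) :=
        Finset.sum_le_sum fun i _ => log_le_log_add (hpos i) hμ
    _ = Fintype.card m * Real.log μ := by
        rw [Finset.sum_add_distrib, Finset.sum_sub_distrib, ← Finset.sum_div, hsum]
        simp [hμ.ne']

/-- The gain in `log_det_le` from one eigenvalue that is at least `L`. -/
lemma log_det_le_sub {A : Matrix m m ℝ} (hA : A.PosDef) {μ L : ℝ} (hμ : 0 < μ) (hL : μ ≤ L)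
    (htr : A.trace = Fintype.card m * μ) {i : m} (hi : L ≤ hA.1.eigenvalues i) :
    Real.log A.det ≤ Fintype.card m * Real.log μ - (L / μ - 1 - Real.log (L / μ)) := by
  have hpos := hA.eigenvalues_pos
  have hsum : ∑ i, hA.1.eigenvalues i = Fintype.card m * μ := by
    rw [← htr, hA.1.trace_eq_sum_eigenvalues]; simp
  have hdet : A.det = ∏ i, hA.1.eigenvalues i := by
    rw [hA.1.det_eq_prod_eigenvalues]; simp
  rw [hdet, Real.log_prod fun i _ => (hpos i).ne']
  have hL0 : 0 < L := hμ.trans_le hL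
  calc ∑ j, Real.log (hA.1.eigenvalues j)
      ≤ ∑ j, (Real.log μ + (hA.1.eigenvalues j / μ - 1) -
          if j = i then L / μ - 1 - Real.log (L / μ) else 0) := by
        refine Finset.sum_le_sum fun j _ => ?_
        split_ifs with h
        · subst h
          -- For this eigenvalue the tangent is taken at `L`; beyond `L` its slope `1 / L` may be
          -- raised to `1 / μ`.
          have h1 := log_le_log_add (hpos j) hL0
          have h2 : (hA.1.eigenvalues j - L) / L ≤ (hA.1.eigenvalues j - L) / μ :=
            div_le_div_of_nonneg_left (sub_nonneg.2 hi) hμ hL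
          rw [sub_div, sub_div, div_self hL0.ne'] at h2
          rw [Real.log_div hL0.ne' hμ.ne']
          linarith
        · simpa using log_le_log_add (hpos j) hμ
    _ = _ := by
        rw [Finset.sum_sub_distrib, Finset.sum_add_distrib, Finset.sum_sub_distrib,
          ← Finset.sum_div, hsum]
        simp [hμ.ne']

/-- If all eigenvalues of `A` are below `L`, then so is its quadratic form on unit vectors. -/
lemma posDef_smul_one_sub {A : Matrix m m ℝ} (hA : A.IsHermitian) {L : ℝ}
    (hL : ∀ i, hA.eigenvalues i < L) : (L • (1 : Matrix m m ℝ) - A).PosDef := by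
  have hU : (hA.eigenvectorUnitary : Matrix m m ℝ) * star (hA.eigenvectorUnitary : Matrix m m ℝ)
      = 1 := Unitary.coe_mul_star_self _
  have h : L • (1 : Matrix m m ℝ) - A = (hA.eigenvectorUnitary : Matrix m m ℝ) *
      diagonal (fun i => L - hA.eigenvalues i) *
        star (hA.eigenvectorUnitary : Matrix m m ℝ) := by
    have hd : diagonal (fun i => L - hA.eigenvalues i) =
        L • (1 : Matrix m m ℝ) - diagonal (RCLike.ofReal ∘ hA.eigenvalues) := by
      rw [smul_one_eq_diagonal, diagonal_sub]; rfl
    rw [hd, mul_sub, sub_mul, mul_smul_comm, mul_one, smul_mul_assoc, hU]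
    conv_lhs => rw [hA.spectral_theorem, Unitary.conjStarAlgAut_apply]
  rw [h]
  exact (IsUnit.posDef_star_right_conjugate_iff (Unitary.toUnits hA.eigenvectorUnitary).isUnit).2
    (.diagonal fun i => sub_pos.2 (hL i))

/-- A positive semidefinite matrix of rank at most `r` and trace `r t` has a Rayleigh quotient
at least `t`. -/
lemma not_posDef_smul_one_sub {B : Matrix m m ℝ} (hB : B.PosSemidef) {r : ℕ} {t : ℝ}
    (ht : 0 < t) (hr : 0 < r) (hrank : B.rank ≤ r) (htr : B.trace = r * t) :
    ¬ (t • (1 : Matrix m m ℝ) - B).PosDef := by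
  intro hpd
  have hlt : ∀ i, hB.1.eigenvalues i < t := by
    intro i
    have hv : (hB.1.eigenvectorBasis i : m → ℝ) ≠ 0 := by
      intro h
      exact hB.1.eigenvectorBasis.orthonormal.ne_zero i (by ext j; exact congrFun h j)
    have h1 := hpd.dotProduct_mulVec_pos hv
    rw [sub_mulVec, smul_mulVec, one_mulVec, hB.1.mulVec_eigenvectorBasis, ← sub_smul,
      dotProduct_smul, smul_eq_mul] at h1
    have h2 : 0 ≤ star (hB.1.eigenvectorBasis i : m → ℝ) ⬝ᵥ (hB.1.eigenvectorBasis i : m → ℝ) :=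
      dotProduct_star_self_nonneg _
    exact sub_pos.1 (pos_of_mul_pos_left h1 h2)
  have hsum : ∑ i, hB.1.eigenvalues i = r * t := by
    rw [← htr, hB.1.trace_eq_sum_eigenvalues]; simp
  have hr' : (0 : ℝ) < r := Nat.cast_pos.2 hr
  obtain ⟨i, -, hi⟩ : ∃ i ∈ Finset.univ, 0 < hB.1.eigenvalues i :=
    Finset.exists_lt_of_sum_lt (by simpa [hsum] using mul_pos hr' ht)
  have hcard : (Finset.univ.filter fun i => hB.1.eigenvalues i ≠ 0).card ≤ r := by
    rwa [hB.1.rank_eq_card_non_zero_eigs, Fintype.card_subtype] at hrank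
  -- At most `r` eigenvalues are nonzero and each is below `t`, so the trace would be less than `r
  -- t`.
  have : ∑ i, hB.1.eigenvalues i < ∑ i, if hB.1.eigenvalues i ≠ 0 then t else 0 := by
    refine Finset.sum_lt_sum (fun j _ => ?_) ⟨i, Finset.mem_univ i, by simpa [hi.ne'] using hlt i⟩
    split_ifs with h
    · exact (hlt j).le
    · exact (not_not.1 h).le
  rw [hsum, ← Finset.sum_filter, Finset.sum_const, nsmul_eq_mul] at this
  have h3 : ((Finset.univ.filter fun i => hB.1.eigenvalues i ≠ 0).card : ℝ) ≤ r := by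
    exact_mod_cast hcard
  nlinarith

end Spectral

/-! ### Rates, capacity and the minimal profile -/

section Capacity

variable {K N : ℕ} {n : Fin K → ℕ}

lemma signatureMatrix_mul_blockDiagonal'_mul_transpose
    (P : (k : Fin K) → Matrix (Fin (n k)) (Fin (n k)) ℝ)
    (S : (k : Fin K) → Matrix (Fin N) (Fin (n k)) ℝ) :
    signatureMatrix S * blockDiagonal' P * (signatureMatrix S)ᵀ =
      ∑ k, S k * P k * (S k)ᵀ := by
  have h : signatureMatrix S * blockDiagonal' P =
      signatureMatrix (fun k => S k * P k) := by
    ext a ⟨k, l⟩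
    simp only [mul_apply, Fintype.sum_sigma, signatureMatrix, of_apply]
    rw [Finset.sum_eq_single k]
    · simp [blockDiagonal'_apply_eq]
    · intro k' _ hk
      exact Finset.sum_eq_zero fun l' _ => by rw [blockDiagonal'_apply_ne _ _ _ hk, mul_zero]
    · simp
  rw [h]
  ext a b
  simp [mul_apply, Fintype.sum_sigma, signatureMatrix, Matrix.sum_apply]

/-- The covariance matrix of the received signal, in units of the noise variance. -/
noncomputable def covariance (σ : ℝ) (P : (k : Fin K) → Matrix (Fin (n k)) (Fin (n k)) ℝ)
    (S : (k : Fin K) → Matrix (Fin N) (Fin (n k)) ℝ) : Matrix (Fin N) (Fin N) ℝ :=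
  1 + (1 / σ ^ 2) • ∑ k, S k * P k * (S k)ᵀ

lemma sumRate_eq (σ : ℝ) (P : (k : Fin K) → Matrix (Fin (n k)) (Fin (n k)) ℝ)
    (S : (k : Fin K) → Matrix (Fin N) (Fin (n k)) ℝ) :
    sumRate σ P S = Real.log (covariance σ P S).det / (2 * N * Real.log 2) := by
  unfold sumRate
  rw [signatureMatrix_mul_blockDiagonal'_mul_transpose, covariance, Real.logb, one_div_mul_eq_div,
    div_div, mul_comm (Real.log 2)]

lemma macSumCapacity_eq (p : Fin K → ℝ) (σ : ℝ) (hN : 1 ≤ N) :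
    macSumCapacity p (1 / 2) (2 * σ ^ 2) =
      N * Real.log (1 + (∑ k, p k) / σ ^ 2) / (2 * N * Real.log 2) := by
  have hN' : (N : ℝ) ≠ 0 := by positivity
  have h2 : Real.log 2 ≠ 0 := (Real.log_pos one_lt_two).ne'
  rw [macSumCapacity, Real.logb, show 2 * σ ^ 2 * (1 / 2) = σ ^ 2 by ring]
  field_simp

namespace Feasible

variable {p : Fin K → ℝ} {P : (k : Fin K) → Matrix (Fin (n k)) (Fin (n k)) ℝ}
  {S : (k : Fin K) → Matrix (Fin N) (Fin (n k)) ℝ}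

lemma posSemidef_signal (h : Feasible p P S) (k : Fin K) : (S k * P k * (S k)ᵀ).PosSemidef := by
  simpa using (h.posSemidef k).mul_mul_conjTranspose_same (S k)

lemma trace_signal (h : Feasible p P S) (hN : 1 ≤ N) (k : Fin K) :
    (S k * P k * (S k)ᵀ).trace = N * p k := by
  have hN' : (N : ℝ) ≠ 0 := by positivity
  rw [← h.power k]
  field_simp

lemma posDef_covariance (h : Feasible p P S) (σ : ℝ) : (covariance σ P S).PosDef :=
  PosDef.one.add_posSemidef
    ((posSemidef_sum _ fun k _ => h.posSemidef_signal k).smul (by positivity))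

lemma trace_covariance (h : Feasible p P S) (σ : ℝ) (hN : 1 ≤ N) :
    (covariance σ P S).trace = Fintype.card (Fin N) * (1 + (∑ k, p k) / σ ^ 2) := by
  rw [covariance, trace_add, trace_one, trace_smul, trace_sum,
    Finset.sum_congr rfl fun k _ => h.trace_signal hN k, ← Finset.mul_sum, smul_eq_mul]
  simp only [Fintype.card_fin]
  ring

lemma sumRate_le (h : Feasible p P S) (hp : ∀ k, 0 < p k) (σ : ℝ) (hN : 1 ≤ N) :
    sumRate σ P S ≤ macSumCapacity p (1 / 2) (2 * σ ^ 2) := by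
  have hm : 0 < 1 + (∑ k, p k) / σ ^ 2 := by
    have := Finset.sum_nonneg fun k (_ : k ∈ Finset.univ) => (hp k).le
    positivity
  have := log_det_le (h.posDef_covariance σ) hm (h.trace_covariance σ hN)
  rw [Fintype.card_fin] at this
  have h2 := Real.log_pos one_lt_two
  rw [sumRate_eq, macSumCapacity_eq p σ hN]
  gcongr

/-- If user `k` has `n k` streams, then some eigenvalue of the covariance is at least the
average signal power per stream of this user. -/
lemma exists_le_eigenvalue (h : Feasible p P S) {σ : ℝ} (hσ : 0 < σ) (hN : 1 ≤ N) {k : Fin K}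
    (hp : 0 < p k) (hk : 1 ≤ n k) :
    ∃ i, 1 + N * p k / n k / σ ^ 2 ≤ (h.posDef_covariance σ).1.eigenvalues i := by
  by_contra! hlt
  have hpd := posDef_smul_one_sub _ hlt
  have hnk : (0 : ℝ) < n k := Nat.cast_pos.2 hk
  have hN' : (0 : ℝ) < N := Nat.cast_pos.2 hN
  refine not_posDef_smul_one_sub (h.posSemidef_signal k) (t := N * p k / n k) (r := n k)
    (by positivity) hk ?_ ?_ ?_
  · exact (rank_mul_le_left _ _).trans <| (rank_mul_le_left _ _).trans <|
      (rank_le_width (S k))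
  · rw [h.trace_signal hN k]; field_simp
  -- With `L` the assumed eigenvalue bound, `σ² (L - covariance)` plus the other users' signals is
  -- `N p k / n k` times the identity minus the signal of user `k`.
  · have hrest : (∑ k' ∈ Finset.univ.erase k, S k' * P k' * (S k')ᵀ).PosSemidef :=
      posSemidef_sum _ fun k' _ => h.posSemidef_signal k'
    convert (hpd.smul (show 0 < σ ^ 2 by positivity)).add_posSemidef hrest using 1
    rw [covariance, ← Finset.add_sum_erase _ _ (Finset.mem_univ k)]
    ext a b
    simp only [Matrix.sub_apply, Matrix.smul_apply, Matrix.add_apply, smul_eq_mul]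
    field_simp
    ring

end Feasible

lemma macSumCapacity_pos {p : Fin K → ℝ} (hK : 1 ≤ K) (hp : ∀ k, 0 < p k) {σ : ℝ} (hσ : 0 < σ) :
    0 < macSumCapacity p (1 / 2) (2 * σ ^ 2) := by
  have : 0 < ∑ k, p k := Finset.sum_pos (fun k _ => hp k) ⟨⟨0, hK⟩, Finset.mem_univ _⟩
  unfold macSumCapacity
  have h : 0 < Real.logb 2 (1 + (∑ k, p k) / (2 * σ ^ 2 * (1 / 2))) :=
    Real.logb_pos one_lt_two (lt_add_of_pos_right 1 (by positivity))
  positivity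

/-- The loss of rate does not depend on the feasible pair, so it survives the passage to the
supremum. -/
theorem AchievesSumCapacity.ceilProfile_le {p : Fin K → ℝ} (hN : 1 ≤ N) (hp : ∀ k, 0 < p k) {σ : ℝ}
    (hσ : 0 < σ) (h : AchievesSumCapacity p N σ n) : ceilProfile p N ≤ n := by
  intro k
  by_contra hlt
  have hT : 0 < ∑ k, p k := Finset.sum_pos (fun k _ => hp k) ⟨k, Finset.mem_univ _⟩
  have hnk : (0 : ℝ) < n k := Nat.cast_pos.2 (h.1 k)
  have hN' : (0 : ℝ) < N := Nat.cast_pos.2 hN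
  have hlt' : (n k : ℝ) < N * (p k / ∑ k', p k') := Nat.lt_ceil.1 (not_le.1 hlt)
  set μ := 1 + (∑ k, p k) / σ ^ 2 with hμ
  set L := 1 + N * p k / n k / σ ^ 2 with hL
  have hμ0 : 0 < μ := by positivity
  have hL0 : 0 < L := by
    have := hp k
    positivity
  have hμL : μ < L := by
    have : ∑ k, p k < N * p k / n k := by
      rw [lt_div_iff₀ hnk]
      rw [← mul_div_assoc, lt_div_iff₀ hT] at hlt'
      linarith
    rw [hμ, hL]
    gcongr
  have hδ : 0 < L / μ - 1 - Real.log (L / μ) :=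
    sub_pos.2 (Real.log_lt_sub_one_of_pos (div_pos hL0 hμ0) ((one_lt_div hμ0).2 hμL).ne')
  have h2 := Real.log_pos one_lt_two
  have hgap : 0 < (L / μ - 1 - Real.log (L / μ)) / (2 * N * Real.log 2) := by positivity
  -- `Real.sSup_le` asks for a nonnegative bound, since `sSup ∅ = 0`; `macSumCapacity_pos` later
  -- excludes the branch `0`.
  have hbound : maxSumRate p n N σ ≤ max 0 (macSumCapacity p (1 / 2) (2 * σ ^ 2) -
      (L / μ - 1 - Real.log (L / μ)) / (2 * N * Real.log 2)) := by
    refine Real.sSup_le ?_ (le_max_left _ _)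
    rintro _ ⟨P, S, hPS, rfl⟩
    refine le_trans ?_ (le_max_right _ _)
    obtain ⟨i, hi⟩ := hPS.exists_le_eigenvalue hσ hN (hp k) (h.1 k)
    have := log_det_le_sub (hPS.posDef_covariance σ) hμ0 hμL.le (hPS.trace_covariance σ hN) hi
    rw [Fintype.card_fin] at this
    rw [sumRate_eq, macSumCapacity_eq p σ hN, ← sub_div]
    gcongr
  rw [h.2] at hbound
  have hpos := macSumCapacity_pos k.pos hp hσ
  rcases le_max_iff.1 hbound with hb | hb <;> linarith

/-- A profile with `n k ≥ N p k / ∑ p k'` admits feasible matrices with white covariance. -/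
theorem macSumCapacity_mem_sumRates {p : Fin K → ℝ} (hK : 1 ≤ K) (hN : 1 ≤ N) (hp : ∀ k, 0 < p k)
    (σ : ℝ) (hn : ceilProfile p N ≤ n) :
    macSumCapacity p (1 / 2) (2 * σ ^ 2) ∈ sumRates p n N σ := by
  have hT : 0 < ∑ k, p k := Finset.sum_pos (fun k _ => hp k) ⟨⟨0, hK⟩, Finset.mem_univ _⟩
  have hN' : (0 : ℝ) < N := Nat.cast_pos.2 hN
  set T := ∑ k, p k with hTdef
  have hle : ∀ k, N * (p k / T) ≤ n k := fun k =>
    (Nat.le_ceil _).trans (Nat.cast_le.2 (hn k))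
  have hpos : ∀ k, 0 < N * (p k / T) := fun k => by have := hp k; positivity
  have hnk : ∀ k, (0 : ℝ) < n k := fun k => (hpos k).trans_le (hle k)
  -- Each user's share `N p k / T` of the dimension is split equally among its streams.
  obtain ⟨V, hV, hcol⟩ := exists_parseval_colSq_eq (m := Fin N)
    (f := fun x : (k : Fin K) × Fin (n k) => N * (p x.1 / T) / n x.1)
    (fun x => (div_pos (hpos x.1) (hnk x.1)).le) (fun x => (div_le_one (hnk x.1)).2 (hle x.1)) (by
      rw [Fintype.sum_sigma]
      have : ∀ k, ∑ _l : Fin (n k), N * (p k / T) / n k = N * (p k / T) := fun k => by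
        have := (hnk k).ne'
        simp only [Finset.sum_const, Finset.card_univ, Fintype.card_fin, nsmul_eq_mul]
        field_simp
      rw [Finset.sum_congr rfl fun k _ => this k, ← Finset.mul_sum, ← Finset.sum_div, ← hTdef,
        div_self hT.ne', mul_one, Fintype.card_fin])
  let S : (k : Fin K) → Matrix (Fin N) (Fin (n k)) ℝ := fun k => Matrix.of fun a l => V a ⟨k, l⟩
  let P : (k : Fin K) → Matrix (Fin (n k)) (Fin (n k)) ℝ := fun k => T • 1
  have hsig : ∀ k, S k * P k * (S k)ᵀ = T • (S k * (S k)ᵀ) := fun k => by simp [P]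
  refine ⟨P, S, ⟨fun k => PosSemidef.one.smul hT.le, fun k => ?_⟩, ?_⟩
  · have htr : (S k * (S k)ᵀ).trace = N * (p k / T) := by
      rw [← sum_colSq]
      have : ∀ l, colSq (S k) l = N * (p k / T) / n k := fun l => hcol ⟨k, l⟩
      have h' := (hnk k).ne'
      simp only [this, Finset.sum_const, Finset.card_univ, Fintype.card_fin, nsmul_eq_mul]
      field_simp
    rw [hsig, trace_smul, htr, smul_eq_mul]
    field_simp
  · have hsum : ∑ k, S k * (S k)ᵀ = 1 := by
      rw [← hV]
      ext a b
      simp [S, mul_apply, Matrix.sum_apply, Fintype.sum_sigma]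
    have hcov : covariance σ P S = (1 + T / σ ^ 2) • (1 : Matrix (Fin N) (Fin N) ℝ) := by
      rw [covariance, Finset.sum_congr rfl fun k _ => hsig k, ← Finset.smul_sum, hsum, smul_smul,
        add_smul, one_smul, one_div_mul_eq_div]
    rw [sumRate_eq, hcov, macSumCapacity_eq p σ hN, det_smul, det_one, mul_one, Fintype.card_fin,
      Real.log_pow]

theorem isGreatest_sumRates {p : Fin K → ℝ} (hK : 1 ≤ K) (hN : 1 ≤ N) (hp : ∀ k, 0 < p k)
    (σ : ℝ) (hn : ceilProfile p N ≤ n) :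
    IsGreatest (sumRates p n N σ) (macSumCapacity p (1 / 2) (2 * σ ^ 2)) := by
  refine ⟨macSumCapacity_mem_sumRates hK hN hp σ hn, ?_⟩
  rintro _ ⟨P, S, hPS, rfl⟩
  exact hPS.sumRate_le hp σ hN

theorem isLeast_ceilProfile {p : Fin K → ℝ} (hK : 1 ≤ K) (hN : 1 ≤ N) (hp : ∀ k, 0 < p k)
    {σ : ℝ} (hσ : 0 < σ) :
    IsLeast {n : Fin K → ℕ | AchievesSumCapacity p N σ n} (ceilProfile p N) := by
  have hT : 0 < ∑ k, p k := Finset.sum_pos (fun k _ => hp k) ⟨⟨0, hK⟩, Finset.mem_univ _⟩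
  have hN' : (0 : ℝ) < N := Nat.cast_pos.2 hN
  refine ⟨⟨fun k => Nat.one_le_ceil_iff.2 (mul_pos hN' (div_pos (hp k) hT)),
    (isGreatest_sumRates hK hN hp σ le_rfl).csSup_eq⟩, fun n hn => hn.ceilProfile_le hN hp hσ⟩

theorem sum_ceilProfile_le {p : Fin K → ℝ} (hK : 1 ≤ K) (hp : ∀ k, 0 < p k) (N : ℕ) :
    ∑ k, ceilProfile p N k ≤ N + (K - 1) := by
  have hne : (Finset.univ : Finset (Fin K)).Nonempty := ⟨⟨0, hK⟩, Finset.mem_univ _⟩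
  have hT : 0 < ∑ k, p k := Finset.sum_pos (fun k _ => hp k) hne
  -- Each ceiling adds strictly less than `1`, so the total is below `N + K`; integrality saves the
  -- last unit.
  have h : ∑ k, (ceilProfile p N k : ℝ) < ∑ k, ((N : ℝ) * (p k / ∑ k', p k') + 1) :=
    Finset.sum_lt_sum_of_nonempty hne fun k _ =>
      Nat.ceil_lt_add_one (mul_nonneg N.cast_nonneg (div_pos (hp k) hT).le)
  rw [Finset.sum_add_distrib, ← Finset.mul_sum, ← Finset.sum_div, div_self hT.ne'] at h
  have h' : ∑ k, ceilProfile p N k < N + K := by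
    have : ((∑ k, ceilProfile p N k : ℕ) : ℝ) < ((N + K : ℕ) : ℝ) := by
      push_cast
      simpa using h
    exact_mod_cast this
  omega

end Capacity

end MultiCodeCDMA

theorem mainTheorem10 (K N : ℕ) (hK : 1 ≤ K) (hN : 1 ≤ N) (p : Fin K → ℝ) (hp : ∀ k, 0 < p k)
    (σ : ℝ) (hσ : 0 < σ) :
    (∀ n : Fin K → ℕ, Minimal (MultiCodeCDMA.AchievesSumCapacity p N σ) n ↔
      n = MultiCodeCDMA.ceilProfile p N) ∧
    IsLeast {n : Fin K → ℕ | MultiCodeCDMA.AchievesSumCapacity p N σ n}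
      (MultiCodeCDMA.ceilProfile p N) ∧
    IsGreatest (MultiCodeCDMA.sumRates p (MultiCodeCDMA.ceilProfile p N) N σ)
      (MultiCodeCDMA.macSumCapacity p (1 / 2) (2 * σ ^ 2)) ∧
    IsLeast {m : ℕ | ∃ n : Fin K → ℕ,
        MultiCodeCDMA.AchievesSumCapacity p N σ n ∧ m = ∑ k, n k}
      (∑ k, MultiCodeCDMA.ceilProfile p N k) ∧
    ∑ k, MultiCodeCDMA.ceilProfile p N k ≤ N + (K - 1) := by
  have hleast := MultiCodeCDMA.isLeast_ceilProfile hK hN hp hσ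
  refine ⟨fun n => ?_, hleast, MultiCodeCDMA.isGreatest_sumRates hK hN hp σ le_rfl,
    ⟨⟨_, hleast.1, rfl⟩, ?_⟩, MultiCodeCDMA.sum_ceilProfile_le hK hp N⟩
  · exact hleast.minimal_iff
  · rintro _ ⟨n, hn, rfl⟩
    exact Finset.sum_le_sum fun k _ => hleast.2 hn k
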